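/- Let $\mathrm{End}_\leq(\mathbf{N})$ be the monoid (under composition) of all order-preserving maps $f\colon\mathbf{N}\to\mathbf{N}$, i.e. $m\leq n$ implies $f(m)\leq f(n)$, and let $\mathrm{Emb}_\leq(\mathbf{N})$, $\mathrm{Epi}_\leq(\mathbf{N})$ and $\mathrm{End}^\infty_\leq(\mathbf{N})$ be its submonoids of injective, surjective and unbounded maps respectively. Endow all four with the topology of pointwise convergence, $\mathbf{N}$ being discrete. For a monoid $S$, a convex compact $S$-space is a convex compact subset $K$ of a Hausdorff real topological vector space $V$ together with an action of $S$ on $V$ by continuous affine transformations preserving $K$. The monoid $S$ is amenable (as an abstract monoid) if every non-empty convex compact $S$-space $K$ contains a point fixed by all of $S$. A topological monoid $S$ is amenable (as a topological monoid) if this holds for every non-empty convex compact $S$-space $K$ for which the action map $S\times K\to K$ is jointly continuous. Theorem. The four monoids $\mathrm{End}_\leq(\mathbf{N})$, $\mathrm{Emb}_\leq(\mathbf{N})$, $\mathrm{Epi}_\leq(\mathbf{N})$ and $\mathrm{End}^\infty_\leq(\mathbf{N})$ are Polish topological monoids; all four are amenable as topological monoids, and none of the four is amenable as an abstract monoid.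 -/

import Mathlib

universe u v

/-- A convex compact `S`-space in the topological vector space `V`: a convex compact set `K ⊆ V`
with an action of the monoid `S` on `V` by continuous affine transformations preserving `K`.
(Multiplication in `V →ᵃ[ℝ] V` is composition.) -/
structure ConvexCompactSpace (S : Type v) [Monoid S] (V : Type u) [AddCommGroup V] [Module ℝ V]
    [TopologicalSpace V] where
  act : S →* (V →ᵃ[ℝ] V)
  continuous_act : ∀ s, Continuous (act s)
  K : Set V
  convex : Convex ℝ K
  isCompact : IsCompact K
  mapsTo : ∀ s, Set.MapsTo (act s) K K

namespace ConvexCompactSpace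

variable {S : Type v} [Monoid S] {V : Type u} [AddCommGroup V] [Module ℝ V] [TopologicalSpace V]

/-- The `S`-action has a fixed point in `K`. -/
def HasFixedPoint (X : ConvexCompactSpace S V) : Prop :=
  ∃ x ∈ X.K, ∀ s, X.act s x = x

/-- The action map `S × K → K` is continuous. -/
def JointlyContinuous [TopologicalSpace S] (X : ConvexCompactSpace S V) : Prop :=
  Continuous fun p : S × X.K => X.act p.1 p.2

end ConvexCompactSpace

/-- Amenability of an abstract monoid: every non-empty convex compact `S`-space in a
Hausdorff real topological vector space has a fixed point. -/
def IsAmenableMonoid (S : Type v) [Monoid S] : Prop :=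
  ∀ (V : Type u) [AddCommGroup V] [Module ℝ V] [TopologicalSpace V] [IsTopologicalAddGroup V]
    [ContinuousSMul ℝ V] [T2Space V] (X : ConvexCompactSpace S V),
    X.K.Nonempty → X.HasFixedPoint

/-- Amenability of a topological monoid: the same fixed-point property, restricted to
jointly continuous actions. -/
def IsAmenableTopMonoid (S : Type v) [Monoid S] [TopologicalSpace S] : Prop :=
  ∀ (V : Type u) [AddCommGroup V] [Module ℝ V] [TopologicalSpace V] [IsTopologicalAddGroup V]
    [ContinuousSMul ℝ V] [T2Space V] (X : ConvexCompactSpace S V),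
    X.JointlyContinuous → X.K.Nonempty → X.HasFixedPoint

/-- The monoid of all order-preserving maps `ℕ → ℕ`, under composition. -/
abbrev EndLE : Type := ℕ →o ℕ

/-- The topology of pointwise convergence (`ℕ` being discrete). -/
instance EndLE.instTopologicalSpace : TopologicalSpace EndLE :=
  TopologicalSpace.induced (fun (f : EndLE) (n : ℕ) => f n) Pi.topologicalSpace

/-- The injective order-preserving maps. -/
def EmbLE : Submonoid EndLE where
  carrier := {f | Function.Injective f}
  one_mem' := Function.injective_id
  mul_mem' := fun {f g} (hf : Function.Injective f) (hg : Function.Injective g) => hf.comp hg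

/-- The surjective order-preserving maps. -/
def EpiLE : Submonoid EndLE where
  carrier := {f | Function.Surjective f}
  one_mem' := Function.surjective_id
  mul_mem' := fun {f g} (hf : Function.Surjective f) (hg : Function.Surjective g) => hf.comp hg

/-- The unbounded order-preserving maps. -/
def EndLEInf : Submonoid EndLE where
  carrier := {f | ∀ N : ℕ, ∃ n : ℕ, N ≤ f n}
  one_mem' := fun N => ⟨N, le_rfl⟩
  mul_mem' := by
    intro f g hf hg N
    obtain ⟨m, hm⟩ := hf N
    obtain ⟨n, hn⟩ := hg m
    exact ⟨n, hm.trans (f.monotone hn)⟩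

/-! Polishness comes from closed embeddings into Polish spaces. An unbounded map is recorded
together with its lower adjoint, so that unboundedness becomes a closed condition. Topological
amenability needs no convexity: each monoid has a fixed point in every compact Hausdorff space on
which it acts continuously. By `exists_common_fixed_point` it suffices to find `d j → 1` and points
`y m` such that `d j • y m` is independent of `j` for large `m`: an ultralimit `w` of `y` then has
`d j • w` independent of `j`, hence equal to `w`. With the shift available, `y` is an orbit of the
shift; for surjections it is a sequence of iterated ultralimits. Approximating arbitrary elements
then shows that `w` is fixed by all. Abstract amenability would yield an invariant mean on `ℕ`,
which is contradicted by explicit maps. -/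

open Filter Topology Set

/-! ### Polish topologies. -/

namespace EndLE

theorem isInducing_coe : IsInducing (fun (f : EndLE) (n : ℕ) => f n) := ⟨rfl⟩

theorem isEmbedding_coe : IsEmbedding (fun (f : EndLE) (n : ℕ) => f n) :=
  ⟨isInducing_coe, DFunLike.coe_injective⟩

theorem continuous_eval (n : ℕ) : Continuous fun f : EndLE => f n :=
  (continuous_apply n).comp isInducing_coe.continuous

theorem isClosed_range_coe : IsClosed (range fun (f : EndLE) (n : ℕ) => f n) := by
  have : (range fun (f : EndLE) (n : ℕ) => f n) = {f : ℕ → ℕ | Monotone f} := by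
    ext f
    exact ⟨by rintro ⟨g, rfl⟩; exact g.monotone, fun h => ⟨⟨f, h⟩, rfl⟩⟩
  rw [this]
  exact isClosed_monotone

instance : PolishSpace EndLE :=
  IsClosedEmbedding.polishSpace ⟨isEmbedding_coe, isClosed_range_coe⟩

instance : ContinuousMul EndLE where
  continuous_mul := by
    refine isInducing_coe.continuous_iff.2 (continuous_pi fun n => ?_)
    have h : Continuous fun p : EndLE × ℕ => p.1 p.2 :=
      continuous_prod_of_discrete_right.2 continuous_eval
    exact h.comp (continuous_fst.prodMk ((continuous_eval n).comp continuous_snd))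

end EndLE

instance : PolishSpace EmbLE := by
  refine IsClosed.polishSpace (s := (EmbLE : Set EndLE)) ?_
  have : (EmbLE : Set EndLE) = ⋂ (m : ℕ) (n : ℕ) (_ : m ≠ n), {f | f m ≠ f n} := by
    ext f
    simp only [mem_iInter, mem_ofPred_eq]
    exact ⟨fun h m n hmn => h.ne hmn, fun h m n => by
      by_contra! hc
      exact h m n hc.2 hc.1⟩
  rw [this]
  refine isClosed_iInter fun m => isClosed_iInter fun n => isClosed_iInter fun _ => ?_
  exact (isClosed_discrete {p : ℕ × ℕ | p.1 ≠ p.2}).preimage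
    ((EndLE.continuous_eval m).prodMk (EndLE.continuous_eval n))

namespace EndLEInf

/-- The lower adjoint of an unbounded order-preserving map. -/
noncomputable def lowerAdjoint (f : EndLEInf) (n : ℕ) : ℕ := sInf {k | n ≤ f.1 k}

theorem lowerAdjoint_le_iff (f : EndLEInf) (n k : ℕ) : lowerAdjoint f n ≤ k ↔ n ≤ f.1 k := by
  refine ⟨fun h => ?_, fun h => Nat.sInf_le h⟩
  exact (Nat.sInf_mem (s := {k | n ≤ f.1 k}) (f.2 n)).trans (f.1.monotone h)

theorem continuous_eval (n : ℕ) : Continuous fun f : EndLEInf => f.1 n :=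
  (EndLE.continuous_eval n).comp continuous_subtype_val

/-- The value at `n` is `k` exactly when `k` is the first place where `f` reaches `n`, which
involves only finitely many values of `f`. -/
theorem continuous_lowerAdjoint : Continuous lowerAdjoint := by
  refine continuous_pi fun n => continuous_discrete_rng.2 fun k => ?_
  have : (fun f => lowerAdjoint f n) ⁻¹' {k} =
      {f : EndLEInf | n ≤ f.1 k} ∩ ⋂ j ∈ Finset.range k, {f : EndLEInf | ¬ n ≤ f.1 j} := by
    ext f
    simp only [mem_preimage, mem_singleton_iff, mem_inter_iff, mem_ofPred_eq, mem_iInter,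
      Finset.mem_range, ← lowerAdjoint_le_iff]
    exact ⟨by rintro rfl; simp, fun h => le_antisymm h.1 (not_lt.1 fun hlt => h.2 _ hlt le_rfl)⟩
  rw [this]
  refine ((isOpen_discrete {m | n ≤ m}).preimage (continuous_eval k)).inter ?_
  exact isOpen_biInter_finset fun j _ =>
    (isOpen_discrete {m | ¬ n ≤ m}).preimage (continuous_eval j)

theorem isClosedEmbedding_coe_lowerAdjoint :
    IsClosedEmbedding fun f : EndLEInf => ((fun n => f.1 n : ℕ → ℕ), lowerAdjoint f) := by
  refine ⟨IsEmbedding.of_comp ?_ continuous_fst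
    (EndLE.isEmbedding_coe.comp IsEmbedding.subtypeVal), ?_⟩
  · exact (continuous_pi continuous_eval).prodMk continuous_lowerAdjoint
  have : (range fun f : EndLEInf => ((fun n => f.1 n : ℕ → ℕ), lowerAdjoint f)) =
      ⋂ (n : ℕ) (k : ℕ), {p : (ℕ → ℕ) × (ℕ → ℕ) | p.2 n ≤ k ↔ n ≤ p.1 k} := by
    ext ⟨f, g⟩
    simp only [mem_range, mem_iInter, mem_ofPred_eq]
    constructor
    · rintro ⟨f, h⟩ n k
      cases h
      exact lowerAdjoint_le_iff f n k
    · intro h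
      have gc : GaloisConnection g f := h
      refine ⟨⟨⟨f, gc.monotone_u⟩, fun N => ⟨g N, gc.le_u_l N⟩⟩, Prod.ext rfl (funext fun n => ?_)⟩
      exact eq_of_forall_ge_iff fun k => (lowerAdjoint_le_iff _ n k).trans (h n k).symm
  rw [this]
  refine isClosed_iInter fun n => isClosed_iInter fun k => ?_
  have hc : Continuous fun p : (ℕ → ℕ) × (ℕ → ℕ) => (p.1 k, p.2 n) := by fun_prop
  exact (isClosed_discrete {q : ℕ × ℕ | q.2 ≤ k ↔ n ≤ q.1}).preimage hc

instance : PolishSpace EndLEInf := isClosedEmbedding_coe_lowerAdjoint.polishSpace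

end EndLEInf

namespace EpiLE

theorem exists_le (f : EpiLE) (N : ℕ) : ∃ n, N ≤ f.1 n := (f.2 N).imp fun _ h => h.ge

theorem apply_zero (f : EpiLE) : f.1 0 = 0 := by
  obtain ⟨k, hk⟩ := f.2 0
  exact Nat.le_zero.1 ((f.1.monotone (Nat.zero_le k)).trans_eq hk)

theorem apply_succ_le (f : EpiLE) (n : ℕ) : f.1 (n + 1) ≤ f.1 n + 1 := by
  obtain ⟨k, hk⟩ := f.2 (f.1 n + 1)
  have hnk : n < k := lt_of_not_ge fun h => by have := f.1.monotone h; omega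
  exact hk ▸ f.1.monotone hnk

/-- A map that starts at zero and climbs by at most one skips no value: it first reaches height `N +
1` at exactly that value. Among unbounded maps, surjectivity is thus closed. -/
theorem mem_of_steps {f : EndLE} (hf : ∀ N, ∃ n, N ≤ f n) (h0 : f 0 = 0)
    (h1 : ∀ n, f (n + 1) ≤ f n + 1) : f ∈ EpiLE := by
  intro N
  induction N with
  | zero => exact ⟨0, h0⟩
  | succ N ih =>
    classical
    have hex := hf (N + 1)
    obtain ⟨j, hj⟩ : ∃ j, Nat.find hex = j + 1 :=
      Nat.exists_eq_succ_of_ne_zero fun h => by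
        have := Nat.find_spec hex
        rw [h, h0] at this
        omega
    have h2 := Nat.find_spec hex
    have h3 := Nat.find_min hex (m := j) (by omega)
    rw [hj] at h2
    exact ⟨j + 1, by have := h1 j; omega⟩

instance : PolishSpace EpiLE := by
  let i : EpiLE → EndLEInf := fun f => ⟨f.1, exists_le f⟩
  refine IsClosedEmbedding.polishSpace (f := i) ⟨IsEmbedding.of_comp
    (continuous_subtype_val.subtype_mk _) continuous_subtype_val IsEmbedding.subtypeVal, ?_⟩
  have : range i = {f | f.1 0 = 0} ∩ ⋂ n : ℕ, {f | f.1 (n + 1) ≤ f.1 n + 1} := by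
    ext f
    simp only [mem_range, mem_inter_iff, mem_ofPred_eq, mem_iInter]
    constructor
    · rintro ⟨f, rfl⟩
      exact ⟨apply_zero f, apply_succ_le f⟩
    · rintro ⟨h0, h1⟩
      exact ⟨⟨f.1, mem_of_steps f.2 h0 h1⟩, rfl⟩
  rw [this]
  refine ((isClosed_discrete {0}).preimage (EndLEInf.continuous_eval 0)).inter
    (isClosed_iInter fun n => ?_)
  exact (isClosed_discrete {q : ℕ × ℕ | q.1 ≤ q.2 + 1}).preimage
    ((EndLEInf.continuous_eval (n + 1)).prodMk (EndLEInf.continuous_eval n))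

end EpiLE

/-! ### Fixed points in compact spaces. -/

/-- If every jointly continuous action on a non-empty compact Hausdorff space has a fixed point,
then the topological monoid is amenable. -/
theorem isAmenableTopMonoid_of_compact {S : Type v} [Monoid S] [TopologicalSpace S]
    (h : ∀ (Y : Type u) [TopologicalSpace Y] [CompactSpace Y] [T2Space Y] [MulAction S Y]
      [ContinuousSMul S Y], Nonempty Y → ∃ y : Y, ∀ s : S, s • y = y) :
    IsAmenableTopMonoid.{u, v} S := by
  intro V _ _ _ _ _ _ X hX hne
  let _ : MulAction S X.K :=
    { smul := fun s x => ⟨X.act s x, X.mapsTo s x.2⟩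
      one_smul := fun x => Subtype.ext (by change X.act 1 x = x; simp)
      mul_smul := fun s t x => Subtype.ext (by
        change X.act (s * t) x = X.act s (X.act t x)
        simp) }
  have : ContinuousSMul S X.K := ⟨hX.subtype_mk _⟩
  have : CompactSpace X.K := isCompact_iff_compactSpace.1 X.isCompact
  obtain ⟨y, hy⟩ := h X.K hne.to_subtype
  exact ⟨y, y.2, fun s => congrArg Subtype.val (hy s)⟩

section CompactSpace

variable {S : Type*} [Monoid S] [TopologicalSpace S]
  {Y : Type*} [TopologicalSpace Y] [T2Space Y] [MulAction S Y] [ContinuousSMul S Y]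

theorem smul_eq_of_tendsto {s : ℕ → S} {t : S} (hs : Tendsto s atTop (𝓝 t)) {y : Y}
    (h : ∀ n, s n • y = y) : t • y = y := by
  refine tendsto_nhds_unique (hs.smul_const y) ?_
  simp only [h]
  exact tendsto_const_nhds

/-- If `d j → 1` and, for every `j`, `d j` eventually sends a sequence `y` in a compact space to a
sequence independent of `j`, then the `d j` have a common fixed point. -/
theorem exists_common_fixed_point [CompactSpace Y] {d : ℕ → S} (hd : Tendsto d atTop (𝓝 1))
    {y z : ℕ → Y} (h : ∀ j, ∀ᶠ m in atTop, d j • y m = z m) : ∃ w : Y, ∀ j, d j • w = w := by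
  obtain ⟨w, hw⟩ : ∃ w, Tendsto y (hyperfilter ℕ) (𝓝 w) :=
    ⟨_, ((hyperfilter ℕ).map y).le_nhds_lim⟩
  obtain ⟨v, hv⟩ : ∃ v, Tendsto z (hyperfilter ℕ) (𝓝 v) :=
    ⟨_, ((hyperfilter ℕ).map z).le_nhds_lim⟩
  have key (j : ℕ) : d j • w = v :=
    tendsto_nhds_unique ((hw.const_smul (d j)).congr' ((h j).filter_mono Nat.hyperfilter_le_atTop))
      hv
  have hvw : v = w := by
    refine tendsto_nhds_unique (f := fun j => d j • w) (l := atTop) ?_ ?_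
    · simp only [key]
      exact tendsto_const_nhds
    · simpa using hd.smul_const w
  exact ⟨w, fun j => (key j).trans hvw⟩

end CompactSpace

theorem EndLE.tendsto_of_forall_eventually_eq {S : Type*} [TopologicalSpace S] {ρ : S → EndLE}
    (hρ : IsInducing ρ) {s : ℕ → S} {t : S}
    (h : ∀ k, ∀ᶠ n in atTop, ρ (s n) k = ρ t k) : Tendsto s atTop (𝓝 t) := by
  refine (EndLE.isInducing_coe.comp hρ).tendsto_nhds_iff.2 (tendsto_pi_nhds.2 fun k => ?_)
  exact tendsto_const_nhds.congr' ((h k).mono fun n hn => hn.symm)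

/-! ### Monoids containing the shift -/

/-- The order embedding of `ℕ` whose range omits exactly `j`. -/
def skip (j : ℕ) : EndLE :=
  ⟨fun k => if k < j then k else k + 1, fun m n h => by dsimp only; split_ifs <;> omega⟩

theorem skip_apply (j k : ℕ) : skip j k = if k < j then k else k + 1 := rfl

theorem skip_zero_pow_apply (n k : ℕ) : (skip 0 ^ n) k = k + n := by
  induction n with
  | zero => rfl
  | succ n ih =>
    rw [pow_succ']
    change skip 0 ((skip 0 ^ n) k) = _
    rw [ih, skip_apply]
    simp [add_assoc]

/-- The map which agrees with `f` up to `N` and has slope one from there on. -/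
def affineTail (f : EndLE) (N : ℕ) : EndLE :=
  ⟨fun k => f (min k N) + (k - N), fun _ _ h =>
    add_le_add (f.monotone (min_le_min_right N h)) (Nat.sub_le_sub_right h N)⟩

theorem affineTail_apply (f : EndLE) (N k : ℕ) : affineTail f N k = f (min k N) + (k - N) := rfl

/-- Only the tail is seen after shifting by `N`, and there the map is a translation. This transfers
invariance under the shift to `affineTail f N`. -/
theorem affineTail_mul_skip_zero_pow (f : EndLE) (N : ℕ) :
    affineTail f N * skip 0 ^ N = skip 0 ^ f N := by
  ext k
  change affineTail f N ((skip 0 ^ N) k) = _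
  rw [skip_zero_pow_apply, skip_zero_pow_apply, affineTail_apply]
  simp [add_comm]

theorem skip_mul_skip_zero_pow {j m : ℕ} (h : j ≤ m) : skip j * skip 0 ^ m = skip 0 ^ (m + 1) := by
  ext k
  change skip j ((skip 0 ^ m) k) = _
  rw [skip_zero_pow_apply, skip_zero_pow_apply, skip_apply, if_neg (by omega)]
  rfl

theorem isAmenableTopMonoid_of_skip {S : Type v} [Monoid S] [TopologicalSpace S] (ρ : S →* EndLE)
    (hρ : IsInducing ρ) (hinj : Function.Injective ρ) (hskip : ∀ j, skip j ∈ range ρ)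
    (htail : ∀ s N, affineTail (ρ s) N ∈ range ρ) : IsAmenableTopMonoid.{u, v} S := by
  refine isAmenableTopMonoid_of_compact fun Y _ _ _ _ _ ⟨x⟩ => ?_
  choose d hd using hskip
  choose r hr using htail
  have hd1 : Tendsto d atTop (𝓝 1) := by
    refine EndLE.tendsto_of_forall_eventually_eq hρ fun k => ?_
    filter_upwards [eventually_gt_atTop k] with j hj
    rw [hd, map_one, skip_apply, if_pos hj]
    rfl
  obtain ⟨w, hw⟩ := exists_common_fixed_point hd1 (y := fun m => d 0 ^ m • x)
    (z := fun m => d 0 ^ (m + 1) • x) fun j => by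
      filter_upwards [eventually_ge_atTop j] with m hm
      rw [smul_smul]
      congr 1
      apply hinj
      simp only [map_mul, map_pow, hd, skip_mul_skip_zero_pow hm]
  have hpow (n : ℕ) : d 0 ^ n • w = w :=
    pow_mem (S := MulAction.stabilizerSubmonoid S w) (hw 0) n
  refine ⟨w, fun s => smul_eq_of_tendsto (s := r s) ?_ fun N => ?_⟩
  · refine EndLE.tendsto_of_forall_eventually_eq hρ fun k => ?_
    filter_upwards [eventually_ge_atTop k] with N hN
    rw [hr, affineTail_apply, min_eq_left hN, Nat.sub_eq_zero_of_le hN, add_zero]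
  · have : r s N * d 0 ^ N = d 0 ^ ρ s N := by
      apply hinj
      simp only [map_mul, map_pow, hd, hr, affineTail_mul_skip_zero_pow]
    rw [← hpow N, smul_smul, this, hpow, hpow]

theorem affineTail_unbounded (f : EndLE) (N M : ℕ) : ∃ n, M ≤ affineTail f N n :=
  ⟨N + M, by rw [affineTail_apply]; omega⟩

theorem skip_mem_EmbLE (j : ℕ) : skip j ∈ EmbLE := by
  intro m n h
  rw [skip_apply, skip_apply] at h
  split_ifs at h <;> omega

theorem affineTail_mem_EmbLE {f : EndLE} (hf : f ∈ EmbLE) (N : ℕ) : affineTail f N ∈ EmbLE := by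
  have hmono : StrictMono f := f.monotone.strictMono_of_injective hf
  refine StrictMono.injective fun m n h => ?_
  rw [affineTail_apply, affineTail_apply]
  rcases lt_or_ge m N with hm | hm
  · have := hmono (show min m N < min n N by omega)
    omega
  · rw [min_eq_right hm, min_eq_right (hm.trans h.le)]
    omega

theorem isAmenableTopMonoid_EndLE : IsAmenableTopMonoid.{u, 0} EndLE :=
  isAmenableTopMonoid_of_skip (MonoidHom.id _) .id Function.injective_id
    (fun j => ⟨skip j, rfl⟩) fun s N => ⟨affineTail s N, rfl⟩

theorem isAmenableTopMonoid_EmbLE : IsAmenableTopMonoid.{u, 0} EmbLE :=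
  isAmenableTopMonoid_of_skip EmbLE.subtype .subtypeVal Subtype.val_injective
    (fun j => ⟨⟨skip j, skip_mem_EmbLE j⟩, rfl⟩)
    fun s N => ⟨⟨affineTail s.1 N, affineTail_mem_EmbLE s.2 N⟩, rfl⟩

theorem isAmenableTopMonoid_EndLEInf : IsAmenableTopMonoid.{u, 0} EndLEInf :=
  isAmenableTopMonoid_of_skip EndLEInf.subtype .subtypeVal Subtype.val_injective
    (fun j => ⟨⟨skip j, fun N => ⟨N, by rw [skip_apply]; split_ifs <;> omega⟩⟩, rfl⟩)
    fun s N => ⟨⟨affineTail s.1 N, affineTail_unbounded s.1 N⟩, rfl⟩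

/-! ### Surjective maps -/

namespace EpiLE

/-- For `s < t`, the surjection collapsing the interval `[s, t)` to the point `s`. -/
def collapse (s t : ℕ) : EpiLE :=
  -- The `max` makes this the identity when `t ≤ s`.
  ⟨⟨fun k => min k s + (k + 1 - max t (s + 1)), fun m n h => by dsimp only; omega⟩,
    fun n => ⟨if n ≤ s then n else n - (s + 1) + max t (s + 1), by
      split_ifs with h
      · change min n s + (n + 1 - max t (s + 1)) = n
        omega
      · change min (n - (s + 1) + max t (s + 1)) s +
          (n - (s + 1) + max t (s + 1) + 1 - max t (s + 1)) = n
        omega⟩⟩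

theorem collapse_apply (s t k : ℕ) :
    (collapse s t).1 k = min k s + (k + 1 - max t (s + 1)) := rfl

/-- The surjection identifying `j` and `j + 1`. -/
def merge (j : ℕ) : EpiLE := collapse j (j + 2)

theorem merge_apply (j k : ℕ) : (merge j).1 k = min k j + (k + 1 - (j + 2)) := by
  rw [merge, collapse_apply, max_eq_left (by omega)]

/-- The two collapses send `[s, t)` to `s` and `[t, r)` to `s + 1`; `merge s` joins these points, so
`t` disappears. -/
theorem merge_mul_collapse_mul_collapse {s t r : ℕ} (hst : s < t) (htr : t < r) :
    merge s * (collapse s t * collapse t r) = collapse s r := by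
  ext k
  change (merge s).1 ((collapse s t).1 ((collapse t r).1 k)) = _
  simp only [merge_apply, collapse_apply]
  omega

theorem merge_mul_collapse {s t : ℕ} (hst : s < t) (j : ℕ) :
    merge (s + j + 1) * collapse s t = collapse s t * merge (t + j) := by
  ext k
  change (merge (s + j + 1)).1 ((collapse s t).1 k) = (collapse s t).1 ((merge (t + j)).1 k)
  simp only [merge_apply, collapse_apply]
  omega

theorem tendsto_merge : Tendsto merge atTop (𝓝 1) := by
  refine EndLE.tendsto_of_forall_eventually_eq (ρ := Subtype.val) .subtypeVal fun k => ?_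
  filter_upwards [eventually_gt_atTop k] with j hj
  rw [merge_apply]
  change _ = k
  omega

/-- The submonoid generated by the maps `merge j` is dense. -/
theorem exists_mem_closure_merge (f : EpiLE) (N : ℕ) :
    ∃ g ∈ Submonoid.closure (range merge), (∀ k ≤ N, g.1 k = f.1 k) ∧
      ∀ k, g.1 (N + k) = f.1 N + k := by
  induction N with
  | zero =>
    refine ⟨1, one_mem _, fun k hk => ?_, fun k => ?_⟩
    · rw [Nat.le_zero.1 hk]
      exact (apply_zero f).symm
    · rw [apply_zero]
      rfl
  | succ N ih =>
    obtain ⟨g, hg, h1, h2⟩ := ih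
    have hle := apply_succ_le f N
    have hge : f.1 N ≤ f.1 (N + 1) := f.1.monotone N.le_succ
    by_cases h : f.1 (N + 1) = f.1 N + 1
    · have h3 (k : ℕ) : g.1 (N + 1 + k) = f.1 (N + 1) + k := by
        rw [add_assoc, h2, h]
        omega
      refine ⟨g, hg, fun k hk => ?_, h3⟩
      rcases hk.lt_or_eq with hk | rfl
      · exact h1 k (by omega)
      · exact h3 0
    -- Here `f` stays constant from `N` to `N + 1` while `g` climbs by one; `merge (f.1 N)` undoes
    -- the climb and leaves values up to `f.1 N` alone.
    · have h3 (k : ℕ) : (merge (f.1 N) * g).1 (N + 1 + k) = f.1 (N + 1) + k := by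
        change (merge (f.1 N)).1 (g.1 (N + 1 + k)) = _
        rw [add_assoc, h2, merge_apply]
        omega
      refine ⟨merge (f.1 N) * g, mul_mem (Submonoid.subset_closure ⟨_, rfl⟩) hg,
        fun k hk => ?_, h3⟩
      rcases hk.lt_or_eq with hk | rfl
      · change (merge (f.1 N)).1 (g.1 k) = _
        have := f.1.monotone (show k ≤ N by omega)
        rw [h1 k (by omega), merge_apply]
        omega
      · exact h3 0

section IteratedLimit

variable {Y : Type*} [TopologicalSpace Y] [CompactSpace Y] [MulAction EpiLE Y]

/-- The iterated limit, for `t₁` to `tₙ` along a non-principal ultrafilter, of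
`collapse s t₁ • collapse t₁ t₂ • ⋯ • x`, the innermost limit being that in `tₙ`. -/
noncomputable def iteratedLimit (x : Y) : ℕ → ℕ → Y
  | 0, _ => x
  | n + 1, s => ((hyperfilter ℕ).map fun t => collapse s t • iteratedLimit x n t).lim

theorem tendsto_iteratedLimit (x : Y) (n s : ℕ) :
    Tendsto (fun t => collapse s t • iteratedLimit x n t) (hyperfilter ℕ)
      (𝓝 (iteratedLimit x (n + 1) s)) :=
  ((hyperfilter ℕ).map fun t => collapse s t • iteratedLimit x n t).le_nhds_lim

theorem eventually_hyperfilter_gt (s : ℕ) : ∀ᶠ t in (hyperfilter ℕ : Filter ℕ), s < t :=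
  (eventually_gt_atTop s).filter_mono Nat.hyperfilter_le_atTop

/-- For `j = 0`, the merge fuses the two outermost collapses, and the limit over the intermediate
`t` becomes constant. Otherwise it passes through the outermost collapse with index lowered by one
relative to the base point. -/
theorem merge_smul_iteratedLimit [T2Space Y] [ContinuousSMul EpiLE Y] (x : Y) (j n s : ℕ) :
    merge (s + j) • iteratedLimit x (n + j + 2) s = iteratedLimit x (n + j + 1) s := by
  induction j generalizing s with
  | zero =>
    refine tendsto_nhds_unique ((tendsto_iteratedLimit x (n + 1) s).const_smul (merge s))
      (tendsto_const_nhds.congr' ?_)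
    filter_upwards [eventually_hyperfilter_gt s] with t hst
    refine tendsto_nhds_unique ((tendsto_iteratedLimit x n s).congr' ?_)
      (((tendsto_iteratedLimit x n t).const_smul (collapse s t)).const_smul (merge s))
    filter_upwards [eventually_hyperfilter_gt t] with r htr
    rw [smul_smul, smul_smul, mul_assoc, merge_mul_collapse_mul_collapse hst htr]
  | succ j ih =>
    refine tendsto_nhds_unique
      ((tendsto_iteratedLimit x (n + j + 2) s).const_smul (merge (s + (j + 1))))
      ((tendsto_iteratedLimit x (n + j + 1) s).congr' ?_)
    filter_upwards [eventually_hyperfilter_gt s] with t hst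
    rw [smul_smul, ← add_assoc, merge_mul_collapse hst, mul_smul, ih]

end IteratedLimit

theorem isAmenableTopMonoid : IsAmenableTopMonoid.{u, 0} EpiLE := by
  refine isAmenableTopMonoid_of_compact fun Y _ _ _ _ _ ⟨x⟩ => ?_
  obtain ⟨w, hw⟩ := exists_common_fixed_point tendsto_merge
    (y := fun m => iteratedLimit x (m + 2) 0) (z := fun m => iteratedLimit x (m + 1) 0) fun j => by
      filter_upwards [eventually_ge_atTop j] with m hm
      obtain ⟨n, rfl⟩ := Nat.exists_eq_add_of_le' hm
      simpa using merge_smul_iteratedLimit x j n 0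
  have hcl : Submonoid.closure (range merge) ≤ MulAction.stabilizerSubmonoid EpiLE w :=
    Submonoid.closure_le.2 (by rintro _ ⟨j, rfl⟩; exact hw j)
  refine ⟨w, fun f => ?_⟩
  choose g hg hgf _ using exists_mem_closure_merge f
  refine smul_eq_of_tendsto (s := g) ?_ fun N => hcl (hg N)
  refine EndLE.tendsto_of_forall_eventually_eq (ρ := Subtype.val) .subtypeVal fun k => ?_
  filter_upwards [eventually_ge_atTop k] with N hN using hgf N k hN

end EpiLE

/-! ### Invariant means and failure of abstract amenability. -/

/-- A finitely additive probability measure on `ℕ` which vanishes on the sets in `𝒩`. -/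
structure IsMeanVanishingOn (𝒩 : Set (Set ℕ)) (μ : Set ℕ → ℝ) : Prop where
  nonneg : ∀ A, 0 ≤ μ A
  univ : μ univ = 1
  union : ∀ A B, Disjoint A B → μ (A ∪ B) = μ A + μ B
  null : ∀ A ∈ 𝒩, μ A = 0

namespace IsMeanVanishingOn

variable {𝒩 : Set (Set ℕ)} {μ : Set ℕ → ℝ}

theorem add_compl (h : IsMeanVanishingOn 𝒩 μ) (A : Set ℕ) : μ A + μ Aᶜ = 1 := by
  rw [← h.union A Aᶜ disjoint_compl_right, union_compl_self, h.univ]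

theorem le_one (h : IsMeanVanishingOn 𝒩 μ) (A : Set ℕ) : μ A ≤ 1 := by
  linarith [h.add_compl A, h.nonneg Aᶜ]

theorem preimage (h : IsMeanVanishingOn 𝒩 μ) {f : ℕ → ℕ} (hf : ∀ A ∈ 𝒩, f ⁻¹' A ∈ 𝒩) :
    IsMeanVanishingOn 𝒩 fun A => μ (f ⁻¹' A) where
  nonneg _ := h.nonneg _
  univ := h.univ
  union _ _ hAB := h.union _ _ (hAB.preimage f)
  null A hA := h.null _ (hf A hA)

theorem ofUltrafilter (p : Ultrafilter ℕ) (hp : ∀ A ∈ 𝒩, A ∉ p) :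
    ∃ μ, IsMeanVanishingOn 𝒩 μ := by
  classical
  refine ⟨fun A => if A ∈ p then 1 else 0, fun A => by split_ifs <;> simp,
    if_pos univ_mem, ?_, ?_⟩
  · intro A B hAB
    have h : ¬ (A ∈ p ∧ B ∈ p) := fun h => by
      have := inter_mem (f := (p : Filter ℕ)) h.1 h.2
      rw [hAB.inter_eq] at this
      exact p.empty_notMem this
    by_cases hA : A ∈ p <;> by_cases hB : B ∈ p <;>
      simp_all [Ultrafilter.union_mem_iff]
  · intro A hA
    simp [hp A hA]

theorem convex (𝒩 : Set (Set ℕ)) :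
    Convex ℝ {x : ULift.{u} (Set ℕ) → ℝ | IsMeanVanishingOn 𝒩 fun A => x ⟨A⟩} := by
  intro x hx y hy a b ha hb hab
  refine ⟨fun A => ?_, ?_, fun A B hAB => ?_, fun A hA => ?_⟩
  · exact add_nonneg (mul_nonneg ha (hx.nonneg A)) (mul_nonneg hb (hy.nonneg A))
  · change a * x ⟨Set.univ⟩ + b * y ⟨Set.univ⟩ = 1
    rw [hx.univ, hy.univ]
    linarith
  · change a * x ⟨A ∪ B⟩ + b * y ⟨A ∪ B⟩ =
      a * x ⟨A⟩ + b * y ⟨A⟩ + (a * x ⟨B⟩ + b * y ⟨B⟩)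
    rw [hx.union A B hAB, hy.union A B hAB]
    ring
  · change a * x ⟨A⟩ + b * y ⟨A⟩ = 0
    rw [hx.null A hA, hy.null A hA]
    ring

theorem isCompact (𝒩 : Set (Set ℕ)) :
    IsCompact {x : ULift.{u} (Set ℕ) → ℝ | IsMeanVanishingOn 𝒩 fun A => x ⟨A⟩} := by
  refine (isCompact_univ_pi fun _ => isCompact_Icc (a := (0 : ℝ)) (b := 1)).of_isClosed_subset
    ?_ fun x hx A _ => ⟨hx.nonneg A.down, hx.le_one A.down⟩
  have : {x : ULift.{u} (Set ℕ) → ℝ | IsMeanVanishingOn 𝒩 fun A => x ⟨A⟩} =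
      (⋂ A, {x | 0 ≤ x ⟨A⟩}) ∩ {x | x ⟨Set.univ⟩ = 1} ∩
      (⋂ (A) (B) (_ : Disjoint A B), {x | x ⟨A ∪ B⟩ = x ⟨A⟩ + x ⟨B⟩}) ∩
      ⋂ A ∈ 𝒩, {x | x ⟨A⟩ = 0} := by
    ext x
    simp only [mem_inter_iff, mem_iInter, mem_ofPred_eq]
    exact ⟨fun h => ⟨⟨⟨h.nonneg, h.univ⟩, h.union⟩, h.null⟩,
      fun h => ⟨h.1.1.1, h.1.1.2, h.1.2, h.2⟩⟩
  rw [this]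
  refine IsClosed.inter (IsClosed.inter (IsClosed.inter ?_ ?_) ?_) ?_
  · exact isClosed_iInter fun A => isClosed_le continuous_const (continuous_apply _)
  · exact isClosed_eq (continuous_apply _) continuous_const
  · exact isClosed_iInter fun A => isClosed_iInter fun B => isClosed_iInter fun _ =>
      isClosed_eq (by fun_prop) (by fun_prop)
  · exact isClosed_iInter fun A => isClosed_iInter fun _ =>
      isClosed_eq (continuous_apply _) continuous_const

end IsMeanVanishingOn

/-- A monoid acting on `ℕ` acts on the space of means which vanish on an invariant family of sets. -/
def meanSpace {S : Type v} [Monoid S] (ρ : S →* EndLE) (𝒩 : Set (Set ℕ))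
    (h𝒩 : ∀ s, ∀ A ∈ 𝒩, ρ s ⁻¹' A ∈ 𝒩) :
    ConvexCompactSpace S (ULift.{u} (Set ℕ) → ℝ) where
  act :=
    { toFun := fun s => (LinearMap.funLeft ℝ ℝ
        fun A : ULift.{u} (Set ℕ) => (⟨ρ s ⁻¹' A.down⟩ : ULift.{u} (Set ℕ))).toAffineMap
      map_one' := by ext x A; simp [LinearMap.funLeft_apply]
      map_mul' := fun s t => by
        ext x A
        simp [LinearMap.funLeft_apply, preimage_comp] }
  continuous_act s := continuous_pi fun A => continuous_apply _
  K := {x | IsMeanVanishingOn 𝒩 fun A => x ⟨A⟩}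
  convex := IsMeanVanishingOn.convex 𝒩
  isCompact := IsMeanVanishingOn.isCompact 𝒩
  mapsTo s _ hx := hx.preimage (h𝒩 s)

/-- A monoid acting on `ℕ` which is amenable as an abstract monoid has an invariant mean on `ℕ`. -/
theorem IsAmenableMonoid.exists_invariant_mean {S : Type v} [Monoid S]
    (hS : IsAmenableMonoid.{u, v} S) (ρ : S →* EndLE) (𝒩 : Set (Set ℕ))
    (h𝒩 : ∀ s, ∀ A ∈ 𝒩, ρ s ⁻¹' A ∈ 𝒩) (p : Ultrafilter ℕ) (hp : ∀ A ∈ 𝒩, A ∉ p) :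
    ∃ μ, IsMeanVanishingOn 𝒩 μ ∧ ∀ s A, μ (ρ s ⁻¹' A) = μ A := by
  obtain ⟨μ, hμ⟩ := IsMeanVanishingOn.ofUltrafilter p hp
  obtain ⟨x, hx, hfix⟩ := hS (ULift.{u} (Set ℕ) → ℝ) (meanSpace ρ 𝒩 h𝒩) ⟨fun A => μ A.down, hμ⟩
  exact ⟨fun A => x ⟨A⟩, hx, fun s A => congrFun (hfix s) ⟨A⟩⟩

/-- An invariant mean would give full mass to the range of `ρ s` and also, pulling back along `ρ t`,
to its complement. -/
theorem not_isAmenableMonoid_of_disjoint_ranges {S : Type v} [Monoid S] (ρ : S →* EndLE) (s t : S)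
    (hst : ∀ m n, ρ s m ≠ ρ t n) : ¬ IsAmenableMonoid.{u, v} S := by
  intro hS
  obtain ⟨μ, hμ, hinv⟩ := hS.exists_invariant_mean ρ ∅ (by simp) (pure 0) (by simp)
  have h1 := hinv s (range (ρ s))
  have h2 := hinv t (range (ρ s))ᶜ
  rw [preimage_range, hμ.univ] at h1
  rw [show ρ t ⁻¹' (range (ρ s))ᶜ = univ from
    eq_univ_of_forall fun n ⟨m, hm⟩ => hst m n hm, hμ.univ] at h2
  linarith [hμ.add_compl (range (ρ s))]

/-- Rounding down to an even number. -/
def roundEven : EndLE := ⟨fun n => 2 * (n / 2), fun m n h => by dsimp only; omega⟩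

/-- Rounding to the odd number in each pair `{2k, 2k + 1}`. -/
def roundOdd : EndLE := ⟨fun n => 2 * (n / 2) + 1, fun m n h => by dsimp only; omega⟩

theorem roundEven_ne_roundOdd (m n : ℕ) : roundEven m ≠ roundOdd n := by
  change 2 * (m / 2) ≠ 2 * (n / 2) + 1
  omega

theorem not_isAmenableMonoid_EndLE : ¬ IsAmenableMonoid.{u, 0} EndLE :=
  not_isAmenableMonoid_of_disjoint_ranges (MonoidHom.id _) roundEven roundOdd roundEven_ne_roundOdd

theorem not_isAmenableMonoid_EndLEInf : ¬ IsAmenableMonoid.{u, 0} EndLEInf :=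
  not_isAmenableMonoid_of_disjoint_ranges EndLEInf.subtype
    ⟨roundEven, fun N => ⟨2 * N, by change N ≤ 2 * (2 * N / 2); omega⟩⟩
    ⟨roundOdd, fun N => ⟨2 * N, by change N ≤ 2 * (2 * N / 2) + 1; omega⟩⟩
    roundEven_ne_roundOdd

theorem not_isAmenableMonoid_EmbLE : ¬ IsAmenableMonoid.{u, 0} EmbLE :=
  not_isAmenableMonoid_of_disjoint_ranges EmbLE.subtype
    ⟨⟨fun n => 2 * n, fun m n h => by dsimp only; omega⟩, fun m n (h : 2 * m = 2 * n) => by omega⟩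
    ⟨⟨fun n => 2 * n + 1, fun m n h => by dsimp only; omega⟩,
      fun m n (h : 2 * m + 1 = 2 * n + 1) => by omega⟩
    fun m n (h : 2 * m = 2 * n + 1) => by omega

/-- The preimages of the even numbers under elements of `EpiLE` are, up to finite sets, arbitrary
infinite co-infinite sets, so that no mean vanishing on finite sets is invariant. -/
theorem not_isAmenableMonoid_EpiLE : ¬ IsAmenableMonoid.{u, 0} EpiLE := by
  intro hS
  -- Surjections fix `0`, so the point mass there is invariant; demanding that finite sets be null
  -- excludes it.
  have hfin (s : EpiLE) (A : Set ℕ) (hA : A.Finite) : (s.1 ⁻¹' A).Finite := by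
    obtain ⟨N, hN⟩ := hA.bddAbove
    obtain ⟨k, hk⟩ := s.2 (N + 1)
    refine (finite_Iio k).subset fun n hn => mem_Iio.2 (lt_of_not_ge fun hkn => ?_)
    have := hN hn
    have := s.1.monotone hkn
    omega
  obtain ⟨μ, hμ, hinv⟩ := hS.exists_invariant_mean EpiLE.subtype {A | A.Finite} hfin
    (hyperfilter ℕ) fun A hA => notMem_hyperfilter_of_finite hA
  have h0 : μ {0} = 0 := hμ.null _ (finite_singleton 0)
  let pred : EpiLE := ⟨⟨fun n => n - 1, fun m n h => by dsimp only; omega⟩, fun n => ⟨n + 1, rfl⟩⟩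
  let a : EpiLE := ⟨⟨fun n => n / 4 + (n + 3) / 4, fun m n h => by dsimp only; omega⟩,
    fun n => ⟨4 * (n / 2) + n % 2, by
      change (4 * (n / 2) + n % 2) / 4 + (4 * (n / 2) + n % 2 + 3) / 4 = n
      omega⟩⟩
  let b : EpiLE := ⟨⟨fun n => min n 1 + (n + 2) / 4 + (n + 1) / 4,
      fun m n h => by dsimp only; omega⟩,
    fun n => ⟨if n = 0 then 0 else 4 * ((n - 1) / 2) + 1 + (n - 1) % 2, by
      split_ifs with h
      · subst h; rfl
      · change min (4 * ((n - 1) / 2) + 1 + (n - 1) % 2) 1 +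
          (4 * ((n - 1) / 2) + 1 + (n - 1) % 2 + 2) / 4 +
          (4 * ((n - 1) / 2) + 1 + (n - 1) % 2 + 1) / 4 = n
        omega⟩⟩
  -- Up to the null set `{0}`, the evens pull back to the odds, to `4ℕ` and to `4ℕ + 2`. Hence their
  -- mass is `1/2`, yet also twice itself.
  have h1 := hinv pred {n | n % 2 = 0}
  have h2 := hinv a {n | n % 2 = 0}
  have h3 := hinv b {n | n % 2 = 0}
  have e1 : EpiLE.subtype pred ⁻¹' {n | n % 2 = 0} = {n | n % 2 = 0}ᶜ ∪ {0} := by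
    ext n
    change (n - 1) % 2 = 0 ↔ ¬ n % 2 = 0 ∨ n = 0
    omega
  have e2 : EpiLE.subtype a ⁻¹' {n | n % 2 = 0} = {n | n % 4 = 0} := by
    ext n
    change (n / 4 + (n + 3) / 4) % 2 = 0 ↔ n % 4 = 0
    omega
  have e3 : EpiLE.subtype b ⁻¹' {n | n % 2 = 0} = {n | n % 4 = 2} ∪ {0} := by
    ext n
    change (min n 1 + (n + 2) / 4 + (n + 1) / 4) % 2 = 0 ↔ n % 4 = 2 ∨ n = 0
    omega
  rw [e1, hμ.union _ _ (by simp), h0] at h1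
  rw [e2] at h2
  rw [e3, hμ.union _ _ (by simp), h0] at h3
  have e4 : ({n | n % 2 = 0} : Set ℕ) = {n | n % 4 = 0} ∪ {n | n % 4 = 2} := by
    ext n
    change n % 2 = 0 ↔ n % 4 = 0 ∨ n % 4 = 2
    omega
  have h4 := hμ.union {n | n % 4 = 0} {n | n % 4 = 2} <| disjoint_left.2
    fun n (h : n % 4 = 0) (h' : n % 4 = 2) => by omega
  rw [← e4] at h4
  linarith [hμ.add_compl {n | n % 2 = 0}]

theorem mainTheorem4 :
    (PolishSpace EndLE ∧ ContinuousMul EndLE ∧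
      PolishSpace EmbLE ∧ ContinuousMul EmbLE ∧
      PolishSpace EpiLE ∧ ContinuousMul EpiLE ∧
      PolishSpace EndLEInf ∧ ContinuousMul EndLEInf) ∧
    (IsAmenableTopMonoid.{u, 0} EndLE ∧ IsAmenableTopMonoid.{u, 0} EmbLE ∧
      IsAmenableTopMonoid.{u, 0} EpiLE ∧ IsAmenableTopMonoid.{u, 0} EndLEInf) ∧
    (¬ IsAmenableMonoid.{u, 0} EndLE ∧ ¬ IsAmenableMonoid.{u, 0} EmbLE ∧
      ¬ IsAmenableMonoid.{u, 0} EpiLE ∧ ¬ IsAmenableMonoid.{u, 0} EndLEInf) :=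
  ⟨⟨inferInstance, inferInstance, inferInstance, inferInstance, inferInstance, inferInstance,
      inferInstance, inferInstance⟩,
    ⟨isAmenableTopMonoid_EndLE, isAmenableTopMonoid_EmbLE, EpiLE.isAmenableTopMonoid,
      isAmenableTopMonoid_EndLEInf⟩,
    not_isAmenableMonoid_EndLE, not_isAmenableMonoid_EmbLE, not_isAmenableMonoid_EpiLE,
    not_isAmenableMonoid_EndLEInf⟩
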